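/- Let $T:[0,1)^2\to[0,1)^2$ be the map $T(x,y)=(y,\{-x+\sqrt2\,y\})$, where $\{w\}=w-\lfloor w\rfloor$ denotes the fractional part of $w$. It is a bijection, so $T^k$ is defined for every $k\in\mathbb Z$. A two-sided sequence $(s_k)_{k\in\mathbb Z}$ is called periodic if there is an integer $p\ge1$ with $s_{k+p}=s_k$ for all $k\in\mathbb Z$, and aperiodic otherwise. **Theorem.** 1. For every $z\in(\mathbb Z[\sqrt2]\cap[0,1))^2$ the sequence $(T^k(z))_{k\in\mathbb Z}$ is periodic. 2. Every integer sequence $(a_k)_{k\in\mathbb Z}$ satisfying $0\le a_{k-1}+\sqrt2\,a_k+a_{k+1}<1$ for all $k\in\mathbb Z$ is periodic. 3. The sequence $\left(T^k\left(\frac{3-\sqrt2}4,\frac{2\sqrt2-1}4\right)\right)_{k\in\mathbb Z}$ is aperiodic. -/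

import Mathlib

/-- The half-open unit square `[0,1)²`. -/
abbrev UnitSquare : Type :=
  {z : ℝ × ℝ // z.1 ∈ Set.Ico (0 : ℝ) 1 ∧ z.2 ∈ Set.Ico (0 : ℝ) 1}

theorem fract_neg_fract_sub (c x y : ℝ) (hx : x ∈ Set.Ico (0 : ℝ) 1) :
    Int.fract (-Int.fract (-x - c * y) - c * y) = x := by
  have h : -Int.fract (-x - c * y) - c * y = x + (⌊-x - c * y⌋ : ℤ) := by
    rw [← Int.self_sub_floor]
    ring
  rw [h, Int.fract_add_intCast]
  exact Int.fract_eq_self.2 hx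

/-- The map `T(x, y) = (y, {-x - c y})` of `[0,1)²` to itself, as a bijection, so that all the
iterates `T ^ k`, `k ∈ ℤ`, make sense. For a quadratic parameter `λ`, the number `c` is the
algebraic conjugate `λ'` of `λ`. -/
noncomputable def squareMap (c : ℝ) : Equiv.Perm UnitSquare where
  toFun z := ⟨(z.1.2, Int.fract (-z.1.1 - c * z.1.2)),
    z.2.2, Int.fract_nonneg _, Int.fract_lt_one _⟩
  invFun z := ⟨(Int.fract (-z.1.2 - c * z.1.1), z.1.1),
    ⟨Int.fract_nonneg _, Int.fract_lt_one _⟩, z.2.1⟩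
  left_inv z := Subtype.ext (Prod.ext (fract_neg_fract_sub c z.1.1 z.1.2 z.2.1) rfl)
  right_inv z := Subtype.ext (Prod.ext rfl (fract_neg_fract_sub c z.1.2 z.1.1 z.2.2))

/-- A two-sided sequence is periodic if it has some positive period. -/
def IsPeriodicSeq {α : Type*} (s : ℤ → α) : Prop :=
  ∃ p : ℤ, 0 < p ∧ Function.Periodic s p

/-- The two-sided `T`-orbit `k ↦ T^k(z)`. -/
def orbitSeq {X : Type*} (T : Equiv.Perm X) (z : X) : ℤ → X :=
  fun k => (T ^ k) z

/-- The conjecture for the parameter `l`: every two-sided integer sequence with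
`0 ≤ a_{k-1} + l a_k + a_{k+1} < 1` for all `k` is periodic. -/
def PeriodicityConjecture (l : ℝ) : Prop :=
  ∀ a : ℤ → ℤ,
    (∀ k : ℤ, 0 ≤ (a (k - 1) : ℝ) + l * (a k : ℝ) + (a (k + 1) : ℝ) ∧
      (a (k - 1) : ℝ) + l * (a k : ℝ) + (a (k + 1) : ℝ) < 1) →
    IsPeriodicSeq a

open Function Relation

/-! The linear part of `planeMap` is a rotation by 45° for the form `x² - √2xy + y²`. Returns to
`Triangle` are governed by `rotA`, `rotB` and, on the cut between them, the translation `rotC`. This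
induced system is self-similar: `shrink`, of ratio `√2 - 1`, carries `Triangle` onto the part where
`rotB` acts, and each induced step lifts to a chain of steps between the shrunken points
(`InducedStep.transGen_shrink`). Hence `shrink` preserves periodicity.

For points over `ℤ[√2]`, apply Galois conjugation. Undoing `shrink` keeps the point in `Triangle`
but contracts its conjugate, since `√2 + 1` has conjugate `1 - √2`; `rotA` is conjugate to an
isometry. So a descent on `conjForm` of the conjugate (`triangle_mem_periodicPts`) must end in a
periodic orbit, because `lt_conjForm` forbids small conjugates. The points of the square outside
`Triangle` are handled by `exists_reaches_sector` and `edge_mem_periodicPts`. The statement on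
integer sequences follows by encoding them as orbits over `ℤ[√2]`.

For the aperiodic point, denominator 4 allows renormalization to cycle: an orbit meets the image of
its own starting point under `shrink^[4]`, a homothety of ratio `(√2 - 1)⁴`, hence infinitely many
points. -/

/-- The piecewise affine map `(x, y) ↦ (y, {√2 y - x})` on the plane. -/
noncomputable def planeMap (z : ℝ × ℝ) : ℝ × ℝ := (z.2, Int.fract (√2 * z.2 - z.1))

/-- The unit square as a subset of the plane. -/
def unitBox : Set (ℝ × ℝ) := {z | z.1 ∈ Set.Ico (0 : ℝ) 1 ∧ z.2 ∈ Set.Ico (0 : ℝ) 1}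

theorem sqrt_two_mul_self : √2 * √2 = (2 : ℝ) := Real.mul_self_sqrt (by norm_num)

theorem sqrt_two_gt : (1.41421 : ℝ) < √2 := Real.lt_sqrt_of_sq_lt (by norm_num)

theorem sqrt_two_lt : √2 < (1.41422 : ℝ) := (Real.sqrt_lt' (by norm_num)).2 (by norm_num)

theorem planeMap_eq {x y : ℝ} (n : ℤ) (h0 : 0 ≤ √2 * y - x + n) (h1 : √2 * y - x + n < 1) :
    planeMap (x, y) = (y, √2 * y - x + n) := by
  have : Int.fract (√2 * y - x) = √2 * y - x + n := by
    rw [← Int.fract_add_intCast _ n]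
    exact Int.fract_eq_self.2 ⟨h0, h1⟩
  simp [planeMap, this]

theorem planeMap_eq_neg {x y : ℝ} (h0 : 1 ≤ √2 * y - x) (h1 : √2 * y - x < 2) :
    planeMap (x, y) = (y, √2 * y - x - 1) := by
  rw [planeMap_eq (-1)] <;> push_cast <;> [skip; linarith; linarith]
  rfl

theorem planeMap_eq_zero {x y : ℝ} (h0 : 0 ≤ √2 * y - x) (h1 : √2 * y - x < 1) :
    planeMap (x, y) = (y, √2 * y - x) := by
  rw [planeMap_eq 0] <;> push_cast <;> [skip; linarith; linarith]
  simp

theorem planeMap_eq_pos {x y : ℝ} (h0 : -1 ≤ √2 * y - x) (h1 : √2 * y - x < 0) :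
    planeMap (x, y) = (y, √2 * y - x + 1) := by
  rw [planeMap_eq 1] <;> push_cast <;> [skip; linarith; linarith]
  rfl

theorem mapsTo_planeMap : Set.MapsTo planeMap unitBox unitBox := fun _ hz =>
  ⟨hz.2, Int.fract_nonneg _, Int.fract_lt_one _⟩

theorem squareMap_coe (z : UnitSquare) : (squareMap (-√2) z).1 = planeMap z.1 := by
  simp only [squareMap, planeMap, Equiv.coe_fn_mk]
  congr 2
  ring

theorem squareMap_iterate_coe (n : ℕ) (z : UnitSquare) :
    ((squareMap (-√2))^[n] z).1 = planeMap^[n] z.1 := by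
  induction n generalizing z with
  | zero => rfl
  | succ n ih => rw [iterate_succ_apply, iterate_succ_apply, ih, squareMap_coe]

theorem injOn_planeMap : Set.InjOn planeMap unitBox := by
  intro z hz w hw h
  have : squareMap (-√2) ⟨z, hz⟩ = squareMap (-√2) ⟨w, hw⟩ := by
    apply Subtype.ext
    rw [squareMap_coe, squareMap_coe]
    exact h
  exact congrArg Subtype.val ((squareMap (-√2)).injective this)

/-! ### Periodic orbits. -/

theorem isPeriodicSeq_orbitSeq {X : Type*} (T : Equiv.Perm X) (z : X) :
    IsPeriodicSeq (orbitSeq T z) ↔ z ∈ periodicPts T := by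
  constructor
  · rintro ⟨p, hp, h⟩
    refine ⟨p.toNat, by omega, ?_⟩
    have h0 := h 0
    simp only [orbitSeq, zero_add, zpow_zero, Equiv.Perm.coe_one, id_eq] at h0
    have hp' : (p.toNat : ℤ) = p := by omega
    rw [← hp', zpow_natCast] at h0
    rw [IsPeriodicPt, IsFixedPt, Equiv.Perm.iterate_eq_pow]
    exact h0
  · rintro ⟨n, hn, h⟩
    refine ⟨n, by exact_mod_cast hn, fun k => ?_⟩
    rw [IsPeriodicPt, IsFixedPt, Equiv.Perm.iterate_eq_pow] at h
    simp only [orbitSeq, zpow_add, zpow_natCast, Equiv.Perm.mul_apply, h]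

theorem isPeriodicSeq_squareMap (z : UnitSquare) :
    IsPeriodicSeq (orbitSeq (squareMap (-√2)) z) ↔ z.1 ∈ periodicPts planeMap := by
  rw [isPeriodicSeq_orbitSeq]
  refine exists_congr fun n => and_congr_right fun _ => ?_
  rw [IsPeriodicPt, IsFixedPt, IsPeriodicPt, IsFixedPt, ← squareMap_iterate_coe, Subtype.ext_iff]

/-- `w` lies on the forward orbit of `z`. -/
def Reaches (z w : ℝ × ℝ) : Prop := ∃ n : ℕ, planeMap^[n] z = w

theorem Reaches.refl (z : ℝ × ℝ) : Reaches z z := ⟨0, rfl⟩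

theorem Reaches.mem_periodicPts {z w : ℝ × ℝ} (h : Reaches z w) (hz : z ∈ periodicPts planeMap) :
    w ∈ periodicPts planeMap := by
  obtain ⟨m, rfl⟩ := h
  obtain ⟨p, hp, hz⟩ := hz
  exact ⟨p, hp, hz.apply_iterate m⟩

/-- Injectivity on the square cancels the iterates leading from `z` to `w`. -/
theorem Reaches.mem_periodicPts_of_mem {z w : ℝ × ℝ} (h : Reaches z w) (hz : z ∈ unitBox)
    (hw : w ∈ periodicPts planeMap) : z ∈ periodicPts planeMap := by
  obtain ⟨m, rfl⟩ := h
  obtain ⟨p, hp, hw⟩ := hw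
  refine ⟨p, hp, injOn_planeMap.iterate mapsTo_planeMap m (mapsTo_planeMap.iterate p hz) hz ?_⟩
  rw [← iterate_add_apply, add_comm, iterate_add_apply]
  exact hw

theorem finite_setOf_reaches {z : ℝ × ℝ} (hz : z ∈ periodicPts planeMap) :
    {w | Reaches z w}.Finite := by
  obtain ⟨p, hp, hz⟩ := hz
  refine ((Set.finite_lt_nat p).image fun n => planeMap^[n] z).subset ?_
  rintro _ ⟨n, rfl⟩
  exact ⟨n % p, Nat.mod_lt _ hp, hz.iterate_mod_apply n⟩

/-! ### The induced map on the triangle. -/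

/-- The open triangle inducing the renormalization. -/
def Triangle (z : ℝ × ℝ) : Prop := 0 < z.2 ∧ √2 * z.2 < z.1 ∧ z.1 < 1

theorem Triangle.mem_unitBox {z : ℝ × ℝ} (h : Triangle z) : z ∈ unitBox := by
  obtain ⟨h1, h2, h3⟩ := h
  have := sqrt_two_gt
  have h4 : z.2 < z.1 := by nlinarith
  exact ⟨⟨by linarith, h3⟩, h1.le, by linarith⟩

/-- The linear form whose level `√2 - 1` cuts the triangle into the two pieces of the
induced map. -/
noncomputable def cutForm (z : ℝ × ℝ) : ℝ := √2 * z.1 - z.2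

/-- The induced map on the part of the triangle where `cutForm` is large. -/
noncomputable def rotA (z : ℝ × ℝ) : ℝ × ℝ := (z.2 - √2 * z.1 + √2, 1 - z.1)

/-- The induced map on the part of the triangle where `cutForm` is small. -/
noncomputable def rotB (z : ℝ × ℝ) : ℝ × ℝ := (1 + √2 * z.2 - z.1, z.2 - √2 * z.1 + √2 - 1)

/-- The induced map on the cut of the triangle. -/
noncomputable def rotC (z : ℝ × ℝ) : ℝ × ℝ := (z.1 + √2 - 1, z.2)

/-- The contracting similarity that conjugates the induced map with its renormalization. -/
noncomputable def shrink (z : ℝ × ℝ) : ℝ × ℝ :=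
  ((√2 - 1) * (√2 * z.1 - z.2), (√2 - 1) * (z.1 - √2 * z.2))

/-- The inverse of `shrink`. -/
noncomputable def expand (z : ℝ × ℝ) : ℝ × ℝ :=
  ((√2 + 1) * (√2 * z.1 - z.2), (√2 + 1) * (z.1 - √2 * z.2))

theorem shrink_expand (z : ℝ × ℝ) : shrink (expand z) = z := by
  have := sqrt_two_mul_self
  ext <;> simp only [shrink, expand] <;> grind

theorem iterate_three_planeMap {z : ℝ × ℝ} (h : Triangle z) (hc : √2 - 1 < cutForm z) :
    planeMap^[3] z = rotA z := by
  obtain ⟨x, y⟩ := z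
  obtain ⟨h1, h2, h3⟩ := h
  simp only [cutForm] at *
  have e2 : √2 * (√2 * y - x + 1) - y = y - √2 * x + √2 := by grind
  have e3 : √2 * (y - √2 * x + √2) - (√2 * y - x + 1) = 1 - x := by grind
  have hy : 0 < √2 * y := by positivity
  have hx : √2 * x < √2 := by nlinarith
  simp only [iterate_succ_apply, iterate_zero_apply, rotA]
  have q1 : planeMap (x, y) = _ := planeMap_eq_pos (by linarith) (by linarith)
  have q2 : planeMap (y, √2 * y - x + 1) = _ := planeMap_eq_zero (by linarith) (by linarith)
  have q3 : planeMap (√2 * y - x + 1, y - √2 * x + √2) = _ :=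
    planeMap_eq_zero (by linarith) (by linarith)
  rw [q1, q2, e2, q3, e3]

theorem iterate_two_planeMap {z : ℝ × ℝ} (h : Triangle z) (hc : cutForm z ≤ √2 - 1) :
    planeMap^[2] z = rotB z := by
  obtain ⟨x, y⟩ := z
  obtain ⟨h1, h2, h3⟩ := h
  simp only [cutForm] at *
  have hl := sqrt_two_lt
  have e2 : √2 * (√2 * y - x + 1) - y = y - √2 * x + √2 := by grind
  have hy : 0 < √2 * y := by positivity
  have hyx : y < x := by nlinarith
  have hx : x ≤ √2 * x := by nlinarith
  simp only [iterate_succ_apply, iterate_zero_apply, rotB]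
  have q1 : planeMap (x, y) = _ := planeMap_eq_pos (by linarith) (by linarith)
  have q2 : planeMap (y, √2 * y - x + 1) = _ := planeMap_eq_neg (by linarith) (by linarith)
  rw [q1, q2, e2]
  exact Prod.ext (by simp only; ring) rfl

theorem iterate_four_planeMap_edge {x : ℝ} (h0 : 0 < x) (h1 : x < 1) (h : √2 * (1 - x) < 1) :
    planeMap^[4] (x, 0) = (1 - x, 0) := by
  have hg := sqrt_two_gt
  have e1 : √2 * 0 - x + 1 = 1 - x := by ring
  have e2 : √2 * (1 - x) - 0 = √2 * (1 - x) := by ring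
  have e3 : √2 * (√2 * (1 - x)) - (1 - x) = 1 - x := by grind
  have e4 : √2 * (1 - x) - √2 * (1 - x) = 0 := by ring
  have hp : 0 < √2 * (1 - x) := mul_pos (by linarith) (by linarith)
  have q1 : planeMap (x, 0) = _ := planeMap_eq_pos (by linarith) (by linarith)
  have q2 : planeMap (0, 1 - x) = _ := planeMap_eq_zero (by linarith) (by linarith)
  have q3 : planeMap (1 - x, √2 * (1 - x)) = _ := planeMap_eq_zero (by linarith) (by linarith)
  have q4 : planeMap (√2 * (1 - x), 1 - x) = _ := planeMap_eq_zero (by linarith) (by linarith)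
  simp only [iterate_succ_apply, iterate_zero_apply]
  rw [q1, e1, q2, e2, q3, e3, q4, e4]

theorem iterate_two_planeMap_edge {x : ℝ} (h0 : 0 < x) (h1 : x < 1) (h : 1 ≤ √2 * (1 - x)) :
    planeMap^[2] (x, 0) = (1 - x, √2 * (1 - x) - 1) := by
  have hl := sqrt_two_lt
  have e1 : √2 * 0 - x + 1 = 1 - x := by ring
  have e2 : √2 * (1 - x) - 0 - 1 = √2 * (1 - x) - 1 := by ring
  have hp : √2 * (1 - x) ≤ √2 := by nlinarith
  have q1 : planeMap (x, 0) = _ := planeMap_eq_pos (by linarith) (by linarith)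
  have q2 : planeMap (0, 1 - x) = _ := planeMap_eq_neg (by linarith) (by linarith)
  simp only [iterate_succ_apply, iterate_zero_apply]
  rw [q1, e1, q2, e2]

/-- On the cut, `rotB` lands on the edge `y = 0`, outside the open triangle; the two edge lemmas
bring the orbit back, in 2 + 4 + 2 steps. -/
theorem iterate_eight_planeMap {z : ℝ × ℝ} (h : Triangle z) (hc : cutForm z = √2 - 1) :
    planeMap^[8] z = rotC z := by
  have hB := iterate_two_planeMap h hc.le
  obtain ⟨x, y⟩ := z
  obtain ⟨h1, h2, h3⟩ := h
  simp only [cutForm] at *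
  have hg := sqrt_two_gt
  have hy : y = √2 * x - √2 + 1 := by linarith
  have e1 : rotB (x, y) = (x + √2 - 1, 0) := by
    subst hy
    ext <;> simp only [rotB] <;> grind
  have e2 : √2 * (√2 * x - √2 + 1) = 2 * x - 2 + √2 := by grind
  rw [hy, e2] at h2
  have h4 : √2 * (1 - (1 - (x + √2 - 1))) - 1 = y := by grind
  have h5 : √2 * (1 - (x + √2 - 1)) < 1 := by nlinarith
  rw [show 8 = 2 + (4 + 2) from rfl, iterate_add_apply, iterate_add_apply, hB, e1,
    iterate_four_planeMap_edge (by nlinarith) (by linarith) h5,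
    iterate_two_planeMap_edge (by linarith) (by nlinarith) (by linarith), h4]
  exact Prod.ext (by simp only [rotC]; ring) rfl

theorem triangle_rotC {z : ℝ × ℝ} (h : Triangle z) (hc : cutForm z = √2 - 1) :
    Triangle (rotC z) := by
  obtain ⟨h1, h2, h3⟩ := h
  have hg := sqrt_two_gt
  simp only [cutForm, rotC, Triangle] at *
  have hy : z.2 = √2 * z.1 - √2 + 1 := by linarith
  have e2 : √2 * (√2 * z.1 - √2 + 1) = 2 * z.1 - 2 + √2 := by grind
  rw [← hy] at e2
  refine ⟨h1, by linarith, by linarith⟩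

theorem triangle_rotA {z : ℝ × ℝ} (h : Triangle z) (hc : √2 - 1 < cutForm z) :
    Triangle (rotA z) := by
  obtain ⟨h1, h2, h3⟩ := h
  simp only [cutForm, rotA, Triangle] at *
  refine ⟨by linarith, by linarith, by linarith⟩

theorem triangle_rotB {z : ℝ × ℝ} (h : Triangle z) (hc : cutForm z < √2 - 1) :
    Triangle (rotB z) := by
  obtain ⟨h1, h2, h3⟩ := h
  have hs := sqrt_two_mul_self
  have hg := sqrt_two_gt
  have e : √2 * (√2 * z.1) = 2 * z.1 := by grind
  simp only [cutForm, rotB, Triangle] at *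
  refine ⟨by linarith, by nlinarith, by linarith⟩

/-- One step of the induced map on the triangle. -/
def InducedStep (z w : ℝ × ℝ) : Prop :=
  Triangle z ∧ (√2 - 1 < cutForm z ∧ w = rotA z ∨ cutForm z < √2 - 1 ∧ w = rotB z ∨
    cutForm z = √2 - 1 ∧ w = rotC z)

theorem InducedStep.triangle {z w : ℝ × ℝ} (h : InducedStep z w) : Triangle w := by
  obtain ⟨h, ⟨hc, rfl⟩ | ⟨hc, rfl⟩ | ⟨hc, rfl⟩⟩ := h
  exacts [triangle_rotA h hc, triangle_rotB h hc, triangle_rotC h hc]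

theorem InducedStep.exists_iterate {z w : ℝ × ℝ} (h : InducedStep z w) :
    ∃ n, 0 < n ∧ planeMap^[n] z = w := by
  obtain ⟨h, ⟨hc, rfl⟩ | ⟨hc, rfl⟩ | ⟨hc, rfl⟩⟩ := h
  exacts [⟨3, by norm_num, iterate_three_planeMap h hc⟩,
    ⟨2, by norm_num, iterate_two_planeMap h hc.le⟩,
    ⟨8, by norm_num, iterate_eight_planeMap h hc⟩]

theorem exists_iterate_of_transGen {z w : ℝ × ℝ} (h : TransGen InducedStep z w) :
    ∃ n, 0 < n ∧ planeMap^[n] z = w := by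
  induction h with
  | single h => exact h.exists_iterate
  | tail _ h ih =>
    obtain ⟨m, hm, rfl⟩ := ih
    obtain ⟨n, hn, rfl⟩ := h.exists_iterate
    exact ⟨n + m, by omega, iterate_add_apply _ _ _ _⟩

theorem reaches_of_reflTransGen {z w : ℝ × ℝ} (h : ReflTransGen InducedStep z w) :
    Reaches z w := by
  rcases reflTransGen_iff_eq_or_transGen.1 h with rfl | h
  · exact Reaches.refl _
  · obtain ⟨n, -, h⟩ := exists_iterate_of_transGen h
    exact ⟨n, h⟩

theorem inducedStep_rotA {z : ℝ × ℝ} (h : Triangle z) (hc : √2 - 1 < cutForm z) :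
    InducedStep z (rotA z) := ⟨h, Or.inl ⟨hc, rfl⟩⟩

theorem inducedStep_rotB {z : ℝ × ℝ} (h : Triangle z) (hc : cutForm z < √2 - 1) :
    InducedStep z (rotB z) := ⟨h, Or.inr (Or.inl ⟨hc, rfl⟩)⟩

theorem inducedStep_rotC {z : ℝ × ℝ} (h : Triangle z) (hc : cutForm z = √2 - 1) :
    InducedStep z (rotC z) := ⟨h, Or.inr (Or.inr ⟨hc, rfl⟩)⟩

theorem exists_inducedStep {z : ℝ × ℝ} (h : Triangle z) : ∃ w, InducedStep z w := by
  rcases lt_trichotomy (cutForm z) (√2 - 1) with hc | hc | hc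
  exacts [⟨_, inducedStep_rotB h hc⟩, ⟨_, inducedStep_rotC h hc⟩, ⟨_, inducedStep_rotA h hc⟩]

/-! ### Self-similarity of the induced map. -/

theorem cutForm_shrink (z : ℝ × ℝ) : cutForm (shrink z) = (√2 - 1) * z.1 := by
  simp only [cutForm, shrink]
  grind

theorem triangle_shrink {z : ℝ × ℝ} (h : Triangle z) : Triangle (shrink z) := by
  obtain ⟨h1, h2, h3⟩ := h
  have hs := sqrt_two_mul_self
  have hg := sqrt_two_gt
  have h4 : 0 < √2 - 1 := by linarith
  have h5 : √2 * z.1 - z.2 < √2 := by nlinarith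
  refine ⟨mul_pos h4 (by linarith), ?_, ?_⟩
  · simp only [shrink]
    have : √2 * ((√2 - 1) * (z.1 - √2 * z.2)) = (√2 - 1) * (√2 * z.1 - 2 * z.2) := by grind
    rw [this]
    exact mul_lt_mul_of_pos_left (by linarith) h4
  · simp only [shrink]
    nlinarith

theorem cutForm_shrink_lt {z : ℝ × ℝ} (h : Triangle z) : cutForm (shrink z) < √2 - 1 := by
  have hg := sqrt_two_gt
  rw [cutForm_shrink]
  nlinarith [h.2.2]

theorem triangle_expand {z : ℝ × ℝ} (h : Triangle z) (hc : cutForm z < √2 - 1) :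
    Triangle (expand z) := by
  obtain ⟨h1, h2, h3⟩ := h
  have hs := sqrt_two_mul_self
  have hg := sqrt_two_gt
  have h4 : 0 < √2 + 1 := by linarith
  simp only [cutForm] at hc
  refine ⟨mul_pos h4 (by linarith), ?_, ?_⟩
  · simp only [expand]
    have : √2 * ((√2 + 1) * (z.1 - √2 * z.2)) = (√2 + 1) * (√2 * z.1 - 2 * z.2) := by grind
    rw [this]
    exact mul_lt_mul_of_pos_left (by linarith) h4
  · simp only [expand]
    nlinarith

theorem rotB_shrink (z : ℝ × ℝ) :
    rotB (shrink z) = (1 - (√2 - 1) * z.2, (√2 - 1) * (1 - z.1)) := by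
  ext <;> simp only [shrink, rotB] <;> grind

theorem rotA_rotB_shrink (z : ℝ × ℝ) : rotA (rotB (shrink z)) = shrink (rotA z) := by
  rw [rotB_shrink]
  ext <;> simp only [shrink, rotA] <;> grind

/-- The linear part of `rotA` is a rotation by 135°, so its fourth power is a half turn about the
fixed point. -/
theorem iterate_four_rotA (z : ℝ × ℝ) : rotA^[4] z = (√2 - z.1, 2 - √2 - z.2) := by
  ext <;> simp only [iterate_succ_apply, iterate_zero_apply, rotA] <;> grind

theorem iterate_eight_rotA (z : ℝ × ℝ) : rotA^[8] z = z := by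
  rw [show 8 = 4 + 4 from rfl, iterate_add_apply, iterate_four_rotA, iterate_four_rotA]
  ext <;> simp only <;> ring

theorem iterate_rotA_rotB_shrink (z : ℝ × ℝ) :
    rotA^[4] (rotB (shrink z)) = shrink (rotB z) := by
  rw [iterate_four_rotA, rotB_shrink]
  ext <;> simp only [shrink, rotB] <;> grind

theorem cutForm_rotA (z : ℝ × ℝ) : cutForm (rotA z) = 1 + √2 * z.2 - z.1 := by
  simp only [cutForm, rotA]
  grind

theorem lt_cutForm_rotB_shrink {z : ℝ × ℝ} (h : Triangle z) :
    √2 - 1 < cutForm (rotB (shrink z)) := by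
  obtain ⟨h1, h2, h3⟩ := h
  have hs := sqrt_two_mul_self
  have hg := sqrt_two_gt
  rw [rotB_shrink]
  simp only [cutForm]
  have : √2 * (1 - (√2 - 1) * z.2) - (√2 - 1) * (1 - z.1)
      = 1 + (√2 - 1) * z.1 - (2 - √2) * z.2 := by grind
  rw [this]
  have h4 : z.2 < z.1 := by nlinarith
  nlinarith

/-- Renormalization is a substitution on itineraries, read in time order: A ↦ BA, B ↦ BAAAA, C ↦
BACA. -/
theorem InducedStep.transGen_shrink {z w : ℝ × ℝ} (h : InducedStep z w) :
    TransGen InducedStep (shrink z) (shrink w) := by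
  obtain ⟨h, hc⟩ := h
  have s1 := inducedStep_rotB (triangle_shrink h) (cutForm_shrink_lt h)
  have s2 := inducedStep_rotA s1.triangle (lt_cutForm_rotB_shrink h)
  obtain ⟨hc, rfl⟩ | ⟨hc, rfl⟩ | ⟨hc, rfl⟩ := hc
  · rw [← rotA_rotB_shrink]
    exact (TransGen.single s1).tail s2
  · obtain ⟨h1, h2, h3⟩ := h
    have hs := sqrt_two_mul_self
    have hg := sqrt_two_gt
    have hyx : z.2 < z.1 := by nlinarith
    have h4 : 0 < √2 - 1 := by linarith
    have s3 := inducedStep_rotA s2.triangle (by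
      rw [rotA_rotB_shrink, cutForm_shrink]
      simp only [cutForm, rotA] at *
      nlinarith)
    have s4 := inducedStep_rotA s3.triangle (by
      rw [cutForm_rotA, rotA_rotB_shrink]
      simp only [cutForm, shrink, rotA] at *
      have e : 1 + √2 * ((√2 - 1) * (z.2 - √2 * z.1 + √2 - √2 * (1 - z.1))) -
          (√2 - 1) * (√2 * (z.2 - √2 * z.1 + √2) - (1 - z.1))
          = √2 - 1 + (2 - √2) + (√2 - 1) * (z.1 - 1) := by grind
      rw [e]
      nlinarith)
    have s5 := inducedStep_rotA s4.triangle (by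
      rw [cutForm_rotA, rotA_rotB_shrink]
      simp only [cutForm, shrink, rotA] at *
      have e : 1 + √2 * (1 - (√2 - 1) * (√2 * (z.2 - √2 * z.1 + √2) - (1 - z.1))) -
          ((√2 - 1) * (z.2 - √2 * z.1 + √2 - √2 * (1 - z.1)) -
          √2 * ((√2 - 1) * (√2 * (z.2 - √2 * z.1 + √2) - (1 - z.1))) + √2)
          = 1 - (√2 - 1) * z.2 := by grind
      rw [e]
      nlinarith)
    rw [← iterate_rotA_rotB_shrink]
    exact ((((TransGen.single s1).tail s2).tail s3).tail s4).tail s5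
  · have hs := sqrt_two_mul_self
    have hg := sqrt_two_gt
    -- On the cut, `rotA` would reach the side `x = 1`, which `shrink` sends back into the cut; this
    -- forces the step `rotC`.
    have e : (rotA z).1 = 1 := by
      simp only [cutForm, rotA] at *
      linarith
    have s3 := inducedStep_rotC s2.triangle (by rw [rotA_rotB_shrink, cutForm_shrink, e, mul_one])
    have e' : rotC (rotA (rotB (shrink z))) = ((√2 - 1) * (z.1 + √2), (√2 - 1) * z.2) := by
      rw [rotA_rotB_shrink]
      simp only [cutForm] at hc
      ext <;> simp only [shrink, rotA, rotC] <;> grind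
    have s4 := inducedStep_rotA s3.triangle (by
      rw [e']
      simp only [cutForm] at *
      have : √2 * ((√2 - 1) * (z.1 + √2)) - (√2 - 1) * z.2
          = (√2 - 1) * 2 + (√2 - 1) * (√2 * z.1 - z.2) := by grind
      rw [this, hc]
      nlinarith)
    have e'' : shrink (rotC z) = rotA (rotC (rotA (rotB (shrink z)))) := by
      rw [e']
      simp only [cutForm] at hc
      ext <;> simp only [shrink, rotA, rotC] <;> grind
    rw [e'']
    exact (((TransGen.single s1).tail s2).tail s3).tail s4

theorem reflTransGen_shrink {z w : ℝ × ℝ} (h : ReflTransGen InducedStep z w) :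
    ReflTransGen InducedStep (shrink z) (shrink w) := by
  induction h with
  | refl => exact ReflTransGen.refl
  | tail _ h ih => exact ih.trans h.transGen_shrink.to_reflTransGen

theorem mem_periodicPts_of_transGen {z : ℝ × ℝ} (h : TransGen InducedStep z z) :
    z ∈ periodicPts planeMap := exists_iterate_of_transGen h

/-- A periodic `planeMap` orbit is finite, so the induced orbit repeats; the repetition lifts
through `shrink`, and injectivity pulls periodicity back to the start. -/
theorem shrink_mem_periodicPts {z : ℝ × ℝ} (h : Triangle z) (hz : z ∈ periodicPts planeMap) :
    shrink z ∈ periodicPts planeMap := by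
  choose! f hf using fun z => exists_inducedStep (z := z)
  have htri : ∀ n, Triangle (f^[n] z) := fun n => by
    induction n with
    | zero => exact h
    | succ n ih => rw [iterate_succ_apply']; exact (hf _ ih).triangle
  have hstep : ∀ n, InducedStep (f^[n] z) (f^[n + 1] z) := fun n => by
    rw [iterate_succ_apply']; exact hf _ (htri n)
  have hlift : ∀ i k, TransGen InducedStep (shrink (f^[i] z)) (shrink (f^[i + k + 1] z)) := by
    intro i k
    induction k with
    | zero => exact (hstep i).transGen_shrink
    | succ k ih => exact ih.trans (hstep _).transGen_shrink
  have hreach : ∀ n, ReflTransGen InducedStep z (f^[n] z) := fun n => by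
    induction n with
    | zero => exact ReflTransGen.refl
    | succ n ih => exact ih.tail (hstep n)
  have hinj : ¬ Injective fun n => f^[n] z := fun hi =>
    Set.infinite_of_injective_forall_mem hi (fun n => reaches_of_reflTransGen (hreach n))
      (finite_setOf_reaches hz)
  obtain ⟨i, j, hij, hlt⟩ : ∃ i j, f^[i] z = f^[j] z ∧ i < j := by
    simp only [Injective, not_forall] at hinj
    obtain ⟨i, j, hij, hne⟩ := hinj
    rcases lt_or_gt_of_ne hne with hlt | hlt
    exacts [⟨i, j, hij, hlt⟩, ⟨j, i, hij.symm, hlt⟩]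
  obtain ⟨k, rfl⟩ := Nat.exists_eq_add_of_lt hlt
  have hper := hlift i k
  rw [← hij] at hper
  exact (reaches_of_reflTransGen (reflTransGen_shrink (hreach i))).mem_periodicPts_of_mem
    (triangle_shrink h).mem_unitBox (mem_periodicPts_of_transGen hper)

/-! ### Galois conjugation and the conjugate form. -/

/-- `w` is the coordinatewise conjugate of the point `z` of `ℤ[√2]²`. -/
def ConjPair (z w : ℝ × ℝ) : Prop :=
  ∃ a b c d : ℤ, z = (a + b * √2, c + d * √2) ∧ w = (a - b * √2, c - d * √2)

/-- The conjugate of `rotA`. -/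
noncomputable def conjRotA (z : ℝ × ℝ) : ℝ × ℝ := (z.2 + √2 * z.1 - √2, 1 - z.1)

/-- The conjugate of `rotC`. -/
noncomputable def conjRotC (z : ℝ × ℝ) : ℝ × ℝ := (z.1 - √2 - 1, z.2)

/-- The conjugate of `expand`. -/
noncomputable def conjExpand (z : ℝ × ℝ) : ℝ × ℝ :=
  ((√2 - 1) * (√2 * z.1 + z.2), (1 - √2) * (z.1 + √2 * z.2))

/-- The quadratic form invariant under the linear part of the conjugate map. -/
noncomputable def conjForm (z : ℝ × ℝ) : ℝ := z.1 ^ 2 + √2 * z.1 * z.2 + z.2 ^ 2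

/-- The conjugate of the fixed point of `rotA`. -/
noncomputable def conjCenter : ℝ × ℝ := (-√2 / 2, 1 + √2 / 2)

theorem ConjPair.rotA {z w : ℝ × ℝ} (h : ConjPair z w) : ConjPair (rotA z) (conjRotA w) := by
  obtain ⟨a, b, c, d, rfl, rfl⟩ := h
  refine ⟨c - 2 * b, d - a + 1, 1 - a, -b, ?_, ?_⟩ <;> ext <;>
    simp only [_root_.rotA, conjRotA] <;> push_cast <;> grind

theorem ConjPair.rotC {z w : ℝ × ℝ} (h : ConjPair z w) : ConjPair (rotC z) (conjRotC w) := by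
  obtain ⟨a, b, c, d, rfl, rfl⟩ := h
  refine ⟨a - 1, b + 1, c, d, ?_, ?_⟩ <;> ext <;>
    simp only [_root_.rotC, conjRotC] <;> push_cast <;> ring

theorem ConjPair.expand {z w : ℝ × ℝ} (h : ConjPair z w) :
    ConjPair (expand z) (conjExpand w) := by
  obtain ⟨a, b, c, d, rfl, rfl⟩ := h
  refine ⟨2 * b - c + 2 * (a - d), 2 * b - c + (a - d), a - 2 * d + 2 * (b - c),
    a - 2 * d + (b - c), ?_, ?_⟩ <;> ext <;>
    simp only [_root_.expand, conjExpand] <;> push_cast <;> grind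

theorem eq_of_add_mul_sqrt_two_eq {a b c d : ℤ} (h : (a : ℝ) + b * √2 = c + d * √2) :
    a = c ∧ b = d := by
  have hbd : b = d := by
    by_contra hne
    have hne' : ((b : ℝ) - d) ≠ 0 := sub_ne_zero.2 (by exact_mod_cast hne)
    apply irrational_sqrt_two
    refine ⟨((c - a : ℤ) : ℚ) / ((b - d : ℤ) : ℚ), ?_⟩
    push_cast
    rw [div_eq_iff hne']
    linarith
  subst hbd
  exact ⟨by exact_mod_cast add_right_cancel h, rfl⟩

theorem ConjPair.snd_eq_of_cutForm_eq {z w : ℝ × ℝ} (h : ConjPair z w)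
    (hc : cutForm z = √2 - 1) : w.2 = √2 + 1 - √2 * w.1 := by
  obtain ⟨a, b, c, d, rfl, rfl⟩ := h
  simp only [cutForm] at *
  have h' : ((2 * b - c : ℤ) : ℝ) + (a - d : ℤ) * √2 = (-1 : ℤ) + (1 : ℤ) * √2 := by
    push_cast
    grind
  obtain ⟨h1, h2⟩ := eq_of_add_mul_sqrt_two_eq h'
  obtain rfl : c = 2 * b + 1 := by omega
  obtain rfl : a = d + 1 := by omega
  push_cast
  grind

theorem conjForm_nonneg (z : ℝ × ℝ) : 0 ≤ conjForm z := by
  have : conjForm z = (z.1 + √2 / 2 * z.2) ^ 2 + z.2 ^ 2 / 2 := by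
    simp only [conjForm]
    grind
  rw [this]
  positivity

/-- The difference of the two sides is half of `conjForm (z - 2w)`. -/
theorem conjForm_add_le (z w : ℝ × ℝ) :
    conjForm (z + w) ≤ 3 / 2 * conjForm z + 3 * conjForm w := by
  have h := conjForm_nonneg (z - (2 : ℝ) • w)
  simp only [conjForm, Prod.fst_add, Prod.snd_add, Prod.fst_sub, Prod.snd_sub, Prod.smul_fst,
    Prod.smul_snd, smul_eq_mul] at *
  linarith

theorem conjForm_conjCenter : conjForm conjCenter = 1 + √2 / 2 := by
  simp only [conjForm, conjCenter]
  grind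

theorem conjForm_sub_conjCenter_le (z : ℝ × ℝ) :
    conjForm (z - conjCenter) ≤ 3 / 2 * conjForm z + 5.2 := by
  have hl := sqrt_two_lt
  have h := conjForm_add_le z (-conjCenter)
  have : conjForm (-conjCenter) = conjForm conjCenter := by simp [conjForm]
  rw [← sub_eq_add_neg, this, conjForm_conjCenter] at h
  linarith

theorem conjForm_le_sub_conjCenter (z : ℝ × ℝ) :
    conjForm z ≤ 3 / 2 * conjForm (z - conjCenter) + 5.2 := by
  have hl := sqrt_two_lt
  have h := conjForm_add_le (z - conjCenter) conjCenter
  rw [sub_add_cancel, conjForm_conjCenter] at h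
  linarith

theorem conjForm_conjRotA_sub (z : ℝ × ℝ) :
    conjForm (conjRotA z - conjCenter) = conjForm (z - conjCenter) := by
  simp only [conjForm, conjRotA, conjCenter, Prod.fst_sub, Prod.snd_sub]
  grind

theorem conjForm_conjExpand (z : ℝ × ℝ) :
    conjForm (conjExpand z) = (3 - 2 * √2) * conjForm z := by
  simp only [conjForm, conjExpand]
  grind

/-- The conjugate of `rotC` is no isometry about `conjCenter`. But conjugating the cut equation
confines `z` to a line, where both sides are quadratics in `z.1`. The bound has the shape of
`conjForm_le_sub_conjCenter`, so both branches of the descent share one estimate. -/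
theorem conjForm_cut_le {z : ℝ × ℝ} (h : z.2 = √2 + 1 - √2 * z.1) :
    conjForm (conjRotA (conjRotC z)) ≤ 3 / 2 * conjForm (z - conjCenter) + 5.2 := by
  have hs := sqrt_two_mul_self
  have e1 : conjForm (z - conjCenter) = z.1 ^ 2 - z.1 + (1 + √2 / 2) := by
    simp only [conjForm, conjCenter, Prod.fst_sub, Prod.snd_sub, h]
    grind
  have e2 : conjForm (conjRotA (conjRotC z)) = z.1 ^ 2 - (2 + √2) * z.1 + (3 + 2 * √2) := by
    simp only [conjForm, conjRotA, conjRotC, h]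
    grind
  rw [e1, e2]
  nlinarith [sq_nonneg (z.1 + 1 / 2 + √2)]

/-- The bound 11 admits `√2 - 1` and just excludes `2 - √2`, whose conjugate squares to about 11.66.
-/
theorem eq_of_sq_conj_le {a b : ℤ} (h0 : 0 < (a : ℝ) + b * √2) (h1 : (a : ℝ) + b * √2 < 1)
    (h : ((a : ℝ) - b * √2) ^ 2 ≤ 11) : a = -1 ∧ b = 1 := by
  have hg := sqrt_two_gt
  obtain ⟨h2, h3⟩ := abs_le_of_sq_le_sq' (b := (3.33 : ℝ)) (h.trans (by norm_num)) (by norm_num)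
  have hb0 : -2 < b := by
    have : (-2 : ℝ) < b := by nlinarith
    exact_mod_cast this
  have hb1 : b < 2 := by
    have : (b : ℝ) < 2 := by nlinarith
    exact_mod_cast this
  have ha0 : -2 < a := by
    have : (-2 : ℝ) < a := by linarith
    exact_mod_cast this
  have ha1 : a < 3 := by
    have : (a : ℝ) < 3 := by linarith
    exact_mod_cast this
  interval_cases b <;> interval_cases a <;> first | exact ⟨rfl, rfl⟩ | (exfalso; push_cast at *; linarith)

/-- Otherwise each conjugate coordinate has square at most `2 * 5.5`, so both coordinates of `z`
equal `√2 - 1`, against `√2 * z.2 < z.1`. -/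
theorem lt_conjForm {z w : ℝ × ℝ} (h : ConjPair z w) (hz : Triangle z) : 5.5 < conjForm w := by
  have hs := sqrt_two_mul_self
  have hg := sqrt_two_gt
  have hl := sqrt_two_lt
  by_contra! hw
  obtain ⟨⟨-, hx1⟩, -, hy1⟩ := hz.mem_unitBox
  obtain ⟨hy0, hyx, -⟩ := hz
  have hx0' : 0 < z.1 := by nlinarith
  have b1 : w.1 ^ 2 ≤ 11 := by
    have : conjForm w = w.1 ^ 2 / 2 + (√2 / 2 * w.1 + w.2) ^ 2 := by
      simp only [conjForm]
      grind
    nlinarith [sq_nonneg (√2 / 2 * w.1 + w.2)]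
  have b2 : w.2 ^ 2 ≤ 11 := by
    have : conjForm w = w.2 ^ 2 / 2 + (√2 / 2 * w.2 + w.1) ^ 2 := by
      simp only [conjForm]
      grind
    nlinarith [sq_nonneg (√2 / 2 * w.2 + w.1)]
  obtain ⟨a, b, c, d, rfl, rfl⟩ := h
  obtain ⟨rfl, rfl⟩ := eq_of_sq_conj_le hx0' hx1 b1
  obtain ⟨rfl, rfl⟩ := eq_of_sq_conj_le hy0 hy1 b2
  push_cast at hyx
  linarith

/-! ### Descent inside the triangle. -/

/-- An orbit that never leaves the domain of `rotA` closes up, as `rotA` has order 8; before leaving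
it, the distance of the conjugate to `conjCenter` is constant. -/
theorem exists_le_cutForm {z z' : ℝ × ℝ} (hz : Triangle z) (h : ConjPair z z') :
    z ∈ periodicPts planeMap ∨ ∃ p p', Triangle p ∧ ConjPair p p' ∧
      conjForm (p' - conjCenter) = conjForm (z' - conjCenter) ∧ cutForm p ≤ √2 - 1 ∧
      ReflTransGen InducedStep z p := by
  by_contra! hcon
  obtain ⟨hper, hcon⟩ := hcon
  have key : ∀ k, ∃ p', Triangle (rotA^[k] z) ∧ ConjPair (rotA^[k] z) p' ∧
      conjForm (p' - conjCenter) = conjForm (z' - conjCenter) ∧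
      ReflTransGen InducedStep z (rotA^[k] z) := by
    intro k
    induction k with
    | zero => exact ⟨z', hz, h, rfl, ReflTransGen.refl⟩
    | succ k ih =>
      obtain ⟨p', h1, h2, h3, h4⟩ := ih
      rw [iterate_succ_apply']
      have hs := inducedStep_rotA h1 (not_le.1 fun hc => hcon _ _ h1 h2 h3 hc h4)
      exact ⟨_, hs.triangle, h2.rotA, (conjForm_conjRotA_sub _).trans h3, h4.tail hs⟩
  obtain ⟨p', h1, h2, h3, h4⟩ := key 7
  have hs := inducedStep_rotA h1 (not_le.1 fun hc => hcon _ _ h1 h2 h3 hc h4)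
  rw [← iterate_succ_apply' rotA 7, iterate_eight_rotA] at hs
  exact hper (mem_periodicPts_of_transGen (TransGen.tail' h4 hs))

theorem cutForm_rotC {z : ℝ × ℝ} (hc : cutForm z = √2 - 1) : cutForm (rotC z) = 1 := by
  simp only [cutForm, rotC] at *
  grind

theorem inducedStep_rotA_rotC {z : ℝ × ℝ} (hz : Triangle z) (hc : cutForm z = √2 - 1) :
    InducedStep (rotC z) (rotA (rotC z)) :=
  inducedStep_rotA (triangle_rotC hz hc) (by
    have := sqrt_two_lt
    rw [cutForm_rotC hc]
    linarith)

theorem rotA_rotC {z : ℝ × ℝ} (hc : cutForm z = √2 - 1) :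
    rotA (rotC z) = (√2 - 1, 2 - √2 - z.1) := by
  simp only [cutForm] at hc
  ext <;> simp only [rotA, rotC] <;> grind

/-- The point of the triangle reached from the boundary point `(t, 0)`. -/
noncomputable def edgePoint (t : ℝ) : ℝ × ℝ := (1 - t, √2 - 1 - √2 * t)

/-- Four `rotA` steps make a half turn onto the cut, and `rotC` follows. Applied twice, the
reflection of `t` gives a closed orbit. -/
theorem transGen_edgePoint {t : ℝ} (h0 : 0 < t) (h1 : t < 3 - 2 * √2) :
    TransGen InducedStep (edgePoint t) (edgePoint (3 - 2 * √2 - t)) := by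
  have hg := sqrt_two_gt
  have htri : Triangle (edgePoint t) := by
    refine ⟨?_, ?_, ?_⟩ <;> simp only [edgePoint]
    · nlinarith
    · have : √2 * (√2 - 1 - √2 * t) = 2 - √2 - 2 * t := by grind
      linarith
    · linarith
  have c0 : cutForm (edgePoint t) = 1 := by
    simp only [cutForm, edgePoint]
    ring
  have s1 := inducedStep_rotA htri (by linarith)
  have s2 := inducedStep_rotA s1.triangle (by
    rw [cutForm_rotA]
    simp only [edgePoint]
    have : 1 + √2 * (√2 - 1 - √2 * t) - (1 - t) = 2 - √2 - t := by grind
    linarith)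
  have s3 := inducedStep_rotA s2.triangle (by
    rw [cutForm_rotA]
    simp only [edgePoint, rotA]
    have : 1 + √2 * (1 - (1 - t)) - (√2 - 1 - √2 * t - √2 * (1 - t) + √2)
      = 1 + √2 * t + (1 - √2) := by ring
    nlinarith)
  have s4 := inducedStep_rotA s3.triangle (by
    rw [cutForm_rotA]
    simp only [edgePoint, rotA]
    have : 1 + √2 * (1 - (√2 - 1 - √2 * t - √2 * (1 - t) + √2)) -
      (1 - (1 - t) - √2 * (√2 - 1 - √2 * t - √2 * (1 - t) + √2) + √2) = 1 - t := by grind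
    linarith)
  have e : rotA^[4] (edgePoint t) = (t + √2 - 1, 3 - 2 * √2 + √2 * t) := by
    rw [iterate_four_rotA]
    ext <;> simp only [edgePoint] <;> ring
  simp only [iterate_succ_apply, iterate_zero_apply] at e
  rw [e] at s4
  have s5 := inducedStep_rotC s4.triangle (by
    simp only [cutForm]
    grind)
  have e' : rotC (t + √2 - 1, 3 - 2 * √2 + √2 * t) = edgePoint (3 - 2 * √2 - t) := by
    ext <;> simp only [rotC, edgePoint] <;> grind
  rw [e'] at s5
  exact ((((TransGen.single s1).tail s2).tail s3).tail s4).tail s5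

theorem rotC_eq_edgePoint {z : ℝ × ℝ} (hc : cutForm z = √2 - 1) :
    rotC z = edgePoint (2 - √2 - z.1) := by
  simp only [cutForm] at hc
  ext <;> simp only [rotC, edgePoint] <;> grind

theorem triangle_mem_periodicPts {z z' : ℝ × ℝ} (hz : Triangle z) (h : ConjPair z z') :
    z ∈ periodicPts planeMap := by
  have hg := sqrt_two_gt
  have hl := sqrt_two_lt
  obtain ⟨n, hn⟩ := exists_nat_ge (conjForm z')
  replace hn : conjForm z' ≤ n + 5.5 := by linarith
  induction n generalizing z z' with
  | zero => exact absurd (lt_conjForm h hz) (by simpa using hn)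
  | succ n ih =>
    push_cast at hn
    -- the renormalized points have smaller conjugates
    have descend : ∀ p p', Triangle p → ConjPair p p' →
        conjForm p' ≤ 3 / 2 * conjForm (z' - conjCenter) + 5.2 → cutForm p < √2 - 1 →
        p ∈ periodicPts planeMap := by
      intro p p' hp hpp' hle hc
      rw [← shrink_expand p]
      refine shrink_mem_periodicPts (triangle_expand hp hc)
        (ih (triangle_expand hp hc) hpp'.expand ?_)
      rw [conjForm_conjExpand]
      have h1 := conjForm_sub_conjCenter_le z'
      have h2 : conjForm p' ≤ 9 / 4 * (n + 6.5) + 13 := by linarith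
      have h3 : (0 : ℝ) ≤ n := n.cast_nonneg
      have h4 : (0 : ℝ) < 3 - 2 * √2 := by linarith
      calc (3 - 2 * √2) * conjForm p' ≤ (3 - 2 * √2) * (9 / 4 * (n + 6.5) + 13) := by gcongr
        -- `3 - 2√2 ≈ 0.1716`, small enough to absorb the losses of both changes of center.
        _ ≤ 0.172 * (9 / 4 * (n + 6.5) + 13) := by
          gcongr
          linarith
        _ ≤ n + 5.5 := by linarith
    obtain hper | ⟨p, p', hp, hpp', hform, hc, hzp⟩ := exists_le_cutForm hz h
    · exact hper
    refine (reaches_of_reflTransGen hzp).mem_periodicPts_of_mem hz.mem_unitBox ?_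
    rcases hc.lt_or_eq with hc | hc
    · exact descend p p' hp hpp' (hform ▸ conjForm_le_sub_conjCenter p') hc
    have s1 := inducedStep_rotC hp hc
    have s2 := inducedStep_rotA_rotC hp hc
    have e := rotA_rotC hc
    have hform' : conjForm (conjRotA (conjRotC p')) ≤ 3 / 2 * conjForm (z' - conjCenter) + 5.2 :=
      hform ▸ conjForm_cut_le (hpp'.snd_eq_of_cutForm_eq hc)
    refine (reaches_of_reflTransGen
      ((ReflTransGen.single s1).tail s2)).mem_periodicPts_of_mem hp.mem_unitBox ?_
    rcases lt_trichotomy (cutForm (rotA (rotC p))) (√2 - 1) with hc' | hc' | hc'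
    · exact descend _ _ s2.triangle hpp'.rotC.rotA hform' hc'
    · have s3 := inducedStep_rotC s2.triangle hc'
      have e3 : rotC (rotA (rotC p)) = rotC p := by
        rw [rotC_eq_edgePoint hc', e, rotC_eq_edgePoint hc]
        simp only [cutForm, e] at hc'
        congr 1
        grind
      rw [e3] at s3
      exact mem_periodicPts_of_transGen ((TransGen.single s3).tail s2)
    · have h0 : 0 < 2 - √2 - p.1 := by
        have := s2.triangle.1
        rwa [e] at this
      have h1 : 2 - √2 - p.1 < 3 - 2 * √2 := by
        simp only [cutForm, e] at hc'
        grind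
      have t1 := transGen_edgePoint h0 h1
      have t2 := transGen_edgePoint (t := 3 - 2 * √2 - (2 - √2 - p.1)) (by linarith) (by linarith)
      rw [sub_sub_cancel] at t2
      have t3 := mem_periodicPts_of_transGen (t1.trans t2)
      rw [← rotC_eq_edgePoint hc] at t3
      exact (reaches_of_reflTransGen (ReflTransGen.single s2)).mem_periodicPts t3

/-! ### From the triangle to the whole square. -/

/-- Both coordinates of `z` lie in `ℤ[√2]`. -/
def IsIntegralPoint (z : ℝ × ℝ) : Prop := ∃ a b c d : ℤ, z = (a + b * √2, c + d * √2)

theorem isIntegralPoint_planeMap {z : ℝ × ℝ} (h : IsIntegralPoint z) : IsIntegralPoint (planeMap z) := by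
  obtain ⟨a, b, c, d, rfl⟩ := h
  refine ⟨c, d, 2 * d - a - ⌊√2 * (c + d * √2) - (a + b * √2)⌋, c - b, ?_⟩
  ext <;> simp only [planeMap, Int.fract]
  push_cast
  grind

theorem IsIntegralPoint.of_reaches {z w : ℝ × ℝ} (h : IsIntegralPoint z) (hzw : Reaches z w) :
    IsIntegralPoint w := by
  obtain ⟨n, rfl⟩ := hzw
  induction n with
  | zero => exact h
  | succ n ih => rw [iterate_succ_apply']; exact isIntegralPoint_planeMap ih

theorem IsIntegralPoint.mem_periodicPts_of_triangle {z : ℝ × ℝ} (h : IsIntegralPoint z)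
    (hz : Triangle z) : z ∈ periodicPts planeMap := by
  obtain ⟨a, b, c, d, rfl⟩ := h
  exact triangle_mem_periodicPts hz ⟨a, b, c, d, rfl, rfl⟩

theorem edge_mem_unitBox {x : ℝ} (h0 : 0 ≤ x) (h1 : x < 1) : (x, (0 : ℝ)) ∈ unitBox :=
  ⟨⟨h0, h1⟩, le_rfl, one_pos⟩

theorem edge_mem_periodicPts_of_lt {x : ℝ} (h : IsIntegralPoint (x, 0)) (h0 : 0 < x) (h1 : x < 1)
    (hx : 1 < √2 * (1 - x)) : (x, 0) ∈ periodicPts planeMap := by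
  have hg := sqrt_two_gt
  have hr : Reaches (x, 0) (1 - x, √2 * (1 - x) - 1) :=
    ⟨2, iterate_two_planeMap_edge h0 h1 hx.le⟩
  refine hr.mem_periodicPts_of_mem (edge_mem_unitBox h0.le h1)
    (IsIntegralPoint.mem_periodicPts_of_triangle (h.of_reaches hr) ⟨?_, ?_, ?_⟩) <;> simp only
  · linarith
  · have : √2 * (√2 * (1 - x) - 1) = 2 * (1 - x) - √2 := by grind
    linarith
  · linarith

/-- The edge orbit either enters the triangle or alternates between `(x, 0)` and `(1 - x, 0)`. -/
theorem edge_mem_periodicPts {x : ℝ} (h : IsIntegralPoint (x, 0)) (h0 : 0 ≤ x) (h1 : x < 1) :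
    (x, 0) ∈ periodicPts planeMap := by
  have hl := sqrt_two_lt
  rcases h0.eq_or_lt with rfl | h0
  · refine ⟨1, one_pos, ?_⟩
    simp [IsPeriodicPt, IsFixedPt, planeMap]
  rcases lt_trichotomy (√2 * (1 - x)) 1 with hx | hx | hx
  · have h4 := iterate_four_planeMap_edge h0 h1 hx
    have hr : Reaches (x, 0) (1 - x, 0) := ⟨4, h4⟩
    have hbox := edge_mem_unitBox h0.le h1
    have h0' : 0 < 1 - x := by linarith
    have h1' : 1 - x < 1 := by linarith
    rcases lt_trichotomy (√2 * (1 - (1 - x))) 1 with hx' | hx' | hx'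
    · refine ⟨4 + 4, by norm_num, ?_⟩
      rw [IsPeriodicPt, IsFixedPt, iterate_add_apply, h4,
        iterate_four_planeMap_edge h0' h1' hx', sub_sub_cancel]
    · refine ⟨2 + 4, by norm_num, ?_⟩
      rw [IsPeriodicPt, IsFixedPt, iterate_add_apply, h4,
        iterate_two_planeMap_edge h0' h1' hx'.ge, hx', sub_sub_cancel, sub_self]
    · exact hr.mem_periodicPts_of_mem hbox
        (edge_mem_periodicPts_of_lt (h.of_reaches hr) h0' h1' hx')
  · refine ⟨4 + 2, by norm_num, ?_⟩
    rw [IsPeriodicPt, IsFixedPt, iterate_add_apply, iterate_two_planeMap_edge h0 h1 hx.ge, hx,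
      sub_self, iterate_four_planeMap_edge (by linarith) (by linarith) (by linarith),
      sub_sub_cancel]
  · exact edge_mem_periodicPts_of_lt h h0 h1 hx

theorem planeMap_eq_of_sector {z : ℝ × ℝ} (hz : z ∈ unitBox) (h : z.1 ≤ √2 * z.2)
    (h' : (planeMap z).1 ≤ √2 * (planeMap z).2) :
    planeMap z = (z.2, √2 * z.2 - z.1) ∧ √2 * z.1 ≤ z.2 := by
  have hs := sqrt_two_mul_self
  have hg := sqrt_two_gt
  obtain ⟨x, y⟩ := z
  obtain ⟨⟨hx0, hx1⟩, hy0, hy1⟩ := hz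
  simp only at *
  rcases lt_or_ge (√2 * y - x) 1 with hf | hf
  · have e := planeMap_eq_zero (by linarith) hf
    refine ⟨e, ?_⟩
    rw [e] at h'
    have : √2 * (√2 * y - x) = 2 * y - √2 * x := by grind
    simp only [this] at h'
    linarith
  · exfalso
    rw [planeMap_eq_neg hf (by nlinarith)] at h'
    simp only at h'
    have : √2 * (√2 * y - x - 1) = 2 * y - √2 * x - √2 := by grind
    nlinarith

/-- While the orbit stays in the sector `x ≤ √2 y`, the map is the linear 45° rotation, which only
the origin can follow for four consecutive points. -/
theorem exists_reaches_sector {z : ℝ × ℝ} (hz : z ∈ unitBox) :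
    z = 0 ∨ ∃ w, Reaches z w ∧ √2 * w.2 < w.1 := by
  by_contra! hcon
  obtain ⟨hne, hcon⟩ := hcon
  have hz1 := mapsTo_planeMap hz
  have h0 := hcon z ⟨0, rfl⟩
  have h1 := hcon (planeMap z) ⟨1, rfl⟩
  have h2 := hcon (planeMap (planeMap z)) ⟨2, rfl⟩
  have h3 := hcon (planeMap (planeMap (planeMap z))) ⟨3, rfl⟩
  obtain ⟨e0, l0⟩ := planeMap_eq_of_sector hz h0 h1
  obtain ⟨e1, l1⟩ := planeMap_eq_of_sector hz1 h1 h2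
  obtain ⟨-, l2⟩ := planeMap_eq_of_sector (mapsTo_planeMap hz1) h2 h3
  rw [e1, e0] at l2
  rw [e0] at l1
  simp only at l1 l2
  obtain ⟨⟨hx, -⟩, hy, -⟩ := hz
  exact hne (Prod.ext (le_antisymm (by simp only [Prod.fst_zero]; linarith) hx)
    (le_antisymm (by simp only [Prod.snd_zero]; linarith) hy))

theorem IsIntegralPoint.mem_periodicPts {z : ℝ × ℝ} (h : IsIntegralPoint z) (hz : z ∈ unitBox) :
    z ∈ periodicPts planeMap := by
  rcases exists_reaches_sector hz with rfl | ⟨w, hzw, hw⟩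
  · exact edge_mem_periodicPts h le_rfl one_pos
  refine hzw.mem_periodicPts_of_mem hz ?_
  have hwi := h.of_reaches hzw
  have hwb : w ∈ unitBox := by
    obtain ⟨n, rfl⟩ := hzw
    exact mapsTo_planeMap.iterate n hz
  obtain ⟨x, y⟩ := w
  obtain ⟨⟨hx0, hx1⟩, hy0, -⟩ := hwb
  rcases hy0.eq_or_lt with hy | hy
  · simp only at hy
    subst hy
    exact edge_mem_periodicPts hwi hx0 hx1
  · exact hwi.mem_periodicPts_of_triangle ⟨hy, hw, hx1⟩

/-! ### Integer sequences. -/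

theorem exists_int_of_mem_adjoin_sqrt_two {x : ℝ} (hx : x ∈ Algebra.adjoin ℤ {√2}) :
    ∃ a b : ℤ, x = a + b * √2 := by
  induction hx using Algebra.adjoin_induction with
  | mem x hx => exact ⟨0, 1, by simpa using hx⟩
  | algebraMap n => exact ⟨n, 0, by simp⟩
  | add x y _ _ hx hy =>
    obtain ⟨a, b, rfl⟩ := hx
    obtain ⟨c, d, rfl⟩ := hy
    exact ⟨a + c, b + d, by push_cast; ring⟩
  | mul x y _ _ hx hy =>
    obtain ⟨a, b, rfl⟩ := hx
    obtain ⟨c, d, rfl⟩ := hy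
    exact ⟨a * c + 2 * b * d, a * d + b * c, by push_cast; grind⟩

theorem orbitSeq_eq_of_forall {X : Type*} (T : Equiv.Perm X) (s : ℤ → X)
    (h : ∀ k, T (s k) = s (k + 1)) : orbitSeq T (s 0) = s := by
  funext k
  induction k using Int.induction_on with
  | zero => rfl
  | succ n ih =>
    rw [orbitSeq] at *
    rw [add_comm, zpow_add, zpow_one, Equiv.Perm.mul_apply, ih, h, add_comm]
  | pred n ih =>
    rw [orbitSeq] at *
    rw [sub_eq_add_neg, add_comm, zpow_add, zpow_neg_one, Equiv.Perm.mul_apply, ih,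
      Equiv.Perm.inv_eq_iff_eq, h]
    congr 1
    ring

theorem periodicityConjecture_sqrt_two : PeriodicityConjecture √2 := by
  intro a ha
  let x : ℤ → ℝ := fun k => a (k - 1) + √2 * a k + a (k + 1)
  have hx : ∀ k, x k ∈ Set.Ico (0 : ℝ) 1 := ha
  let s : ℤ → UnitSquare := fun k => ⟨(x k, x (k + 1)), hx k, hx (k + 1)⟩
  have hT : ∀ k, squareMap (-√2) (s k) = s (k + 1) := by
    intro k
    apply Subtype.ext
    rw [squareMap_coe]
    -- The terms in `√2 * a k` cancel, so the defect is an integer and must be the one removed by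
    -- the fractional part.
    have e : √2 * x (k + 1) - x k + (a (k + 3) + a (k - 1) : ℤ) = x (k + 1 + 1) := by
      simp only [x, show k + 1 - 1 = k by ring, show k + 1 + 1 = k + 2 by ring,
        show k + 2 - 1 = k + 1 by ring, show k + 2 + 1 = k + 3 by ring]
      push_cast
      grind
    have h2 := hx (k + 1 + 1)
    rw [← e] at h2
    change planeMap (x k, x (k + 1)) = (x (k + 1), x (k + 1 + 1))
    rw [planeMap_eq _ h2.1 h2.2, e]
  have hper : IsPeriodicSeq (orbitSeq (squareMap (-√2)) (s 0)) := by
    rw [isPeriodicSeq_squareMap]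
    refine IsIntegralPoint.mem_periodicPts ⟨a (-1) + a 1, a 0, a 0 + a 2, a 1, ?_⟩ (s 0).2
    ext <;> simp only [s, x, zero_add, zero_sub, sub_self, one_add_one_eq_two] <;> push_cast <;>
      ring
  rw [orbitSeq_eq_of_forall _ s hT] at hper
  obtain ⟨p, hp, h⟩ := hper
  refine ⟨p, hp, fun k => ?_⟩
  have hk : x (k + p) = x k := congrArg (fun z : UnitSquare => z.1.1) (h k)
  -- By irrationality `a k` is recovered from `x k` as its coefficient of `√2`.
  refine (eq_of_add_mul_sqrt_two_eq (a := a (k + p - 1) + a (k + p + 1))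
    (c := a (k - 1) + a (k + 1)) ?_).2
  simp only [x] at hk
  push_cast
  linarith

/-! ### The aperiodic point. -/

theorem iterate_four_shrink (z : ℝ × ℝ) : shrink^[4] z = (17 - 12 * √2) • z := by
  ext <;> simp only [iterate_succ_apply, iterate_zero_apply, shrink, Prod.smul_fst, Prod.smul_snd,
    smul_eq_mul] <;> grind

/-- The renormalized orbit of this point is periodic. -/
noncomputable def seed (t : ℝ) : ℝ × ℝ := ((1 + 2 * √2) / 4, t / 4)

/-- The bound 2.6 covers the largest parameter needed, `1 + √2`, and keeps `seed t` in the triangle,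
which requires `t < 2 + √2 / 2`. -/
theorem inducedStep_seed {t : ℝ} (h0 : 0 < t) (h1 : t < 2.6) :
    InducedStep (seed t) (rotA (seed t)) := by
  have hs := sqrt_two_mul_self
  have hg := sqrt_two_gt
  have hl := sqrt_two_lt
  apply inducedStep_rotA
  · simp only [Triangle, seed]
    refine ⟨by linarith, by nlinarith, by linarith⟩
  · simp only [cutForm, seed]
    linarith

/-- Renormalization cycles through the seeds `1`, `1 + √2`, `√2 - 1`, at a cost of one, one and two
applications of `shrink`. -/
theorem shrink_seed_reflTransGen :
    ReflTransGen InducedStep (shrink (seed 1)) (shrink^[4] (shrink (seed 1))) := by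
  have hs := sqrt_two_mul_self
  have hg := sqrt_two_gt
  have hl := sqrt_two_lt
  have t1 : ReflTransGen InducedStep (seed 1) (shrink (seed (1 + √2))) := by
    have e : rotA (seed 1) = shrink (seed (1 + √2)) := by
      ext <;> simp only [rotA, shrink, seed] <;> grind
    rw [← e]
    exact ReflTransGen.single (inducedStep_seed (by norm_num) (by norm_num))
  have t2 : ReflTransGen InducedStep (seed (1 + √2)) (shrink (seed (√2 - 1))) := by
    have e : rotA (rotA (seed (1 + √2))) = shrink (seed (√2 - 1)) := by
      ext <;> simp only [rotA, shrink, seed] <;> grind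
    rw [← e]
    have s1 := inducedStep_seed (t := 1 + √2) (by linarith) (by linarith)
    refine (ReflTransGen.single s1).tail (inducedStep_rotA s1.triangle ?_)
    rw [cutForm_rotA]
    simp only [seed]
    linarith
  have t3 : ReflTransGen InducedStep (seed (√2 - 1)) (shrink (shrink (seed 1))) := by
    have e : rotA (seed (√2 - 1)) = shrink (shrink (seed 1)) := by
      ext <;> simp only [rotA, shrink, seed] <;> grind
    rw [← e]
    exact ReflTransGen.single (inducedStep_seed (by linarith) (by linarith))
  have t := t1.trans (reflTransGen_shrink (t2.trans (reflTransGen_shrink t3)))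
  exact reflTransGen_shrink t

theorem shrink_seed_notMem_periodicPts : shrink (seed 1) ∉ periodicPts planeMap := by
  have hg := sqrt_two_gt
  have hl := sqrt_two_lt
  intro hper
  have hlift : ∀ u v, ReflTransGen InducedStep u v →
      ReflTransGen InducedStep (shrink^[4] u) (shrink^[4] v) := fun u v h =>
    reflTransGen_shrink (reflTransGen_shrink (reflTransGen_shrink (reflTransGen_shrink h)))
  have hreach : ∀ n, ReflTransGen InducedStep (shrink (seed 1))
      ((17 - 12 * √2) ^ n • shrink (seed 1)) := by
    intro n
    induction n with
    | zero =>
      rw [pow_zero, one_smul]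
    | succ n ih =>
      rw [pow_succ', mul_smul, ← iterate_four_shrink]
      exact shrink_seed_reflTransGen.trans (hlift _ _ ih)
  have hpos : 0 < (shrink (seed 1)).1 := by
    have : (shrink (seed 1)).1 = (2 * √2 - 1) / 4 := by
      simp only [shrink, seed]
      grind
    rw [this]
    linarith
  have hinj : Injective fun n : ℕ => (17 - 12 * √2) ^ n • shrink (seed 1) := by
    intro m n hmn
    have h1 := congrArg Prod.fst hmn
    simp only [Prod.smul_fst, smul_eq_mul] at h1
    exact pow_right_injective₀ (by linarith) (by linarith) (mul_right_cancel₀ hpos.ne' h1)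
  exact Set.infinite_of_injective_forall_mem hinj
    (fun n => reaches_of_reflTransGen (hreach n)) (finite_setOf_reaches hper)

theorem mainTheorem5 :
    (∀ z : UnitSquare,
      z.1.1 ∈ Algebra.adjoin ℤ {Real.sqrt 2} → z.1.2 ∈ Algebra.adjoin ℤ {Real.sqrt 2} →
        IsPeriodicSeq (orbitSeq (squareMap (-Real.sqrt 2)) z)) ∧
    PeriodicityConjecture (Real.sqrt 2) ∧
    (∃ z : UnitSquare,
      z.1 = ((3 - Real.sqrt 2) / 4, (2 * Real.sqrt 2 - 1) / 4) ∧
        ¬ IsPeriodicSeq (orbitSeq (squareMap (-Real.sqrt 2)) z)) := by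
  have hg := sqrt_two_gt
  have hl := sqrt_two_lt
  refine ⟨fun z h1 h2 => ?_, periodicityConjecture_sqrt_two, ⟨_, ?_⟩, rfl, ?_⟩
  · rw [isPeriodicSeq_squareMap]
    obtain ⟨a, b, h1⟩ := exists_int_of_mem_adjoin_sqrt_two h1
    obtain ⟨c, d, h2⟩ := exists_int_of_mem_adjoin_sqrt_two h2
    exact IsIntegralPoint.mem_periodicPts ⟨a, b, c, d, Prod.ext h1 h2⟩ z.2
  · refine ⟨⟨?_, ?_⟩, ?_, ?_⟩ <;> simp only <;> linarith
  · rw [isPeriodicSeq_squareMap]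
    intro hper
    -- One step of `planeMap` takes the given point to `shrink (seed 1) = ((2√2 - 1)/4, 1/4)`.
    refine shrink_seed_notMem_periodicPts (Reaches.mem_periodicPts ⟨1, ?_⟩ hper)
    have e : √2 * ((2 * √2 - 1) / 4) - (3 - √2) / 4 = 1 / 4 := by grind
    rw [iterate_one, planeMap_eq_zero (by linarith) (by linarith), e]
    ext <;> simp only [shrink, seed] <;> grind
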